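/- **Setting.** A multi-colour set in $\mathbb{R}^d$ is a family $\Lambda=(\Lambda_i)_{i\le m}$ of subsets of $\mathbb{R}^d$. It is a Delone multi-colour set if each $\Lambda_i$ and $\bigcup_{i\le m}\Lambda_i$ are Delone (uniformly discrete and relatively dense). A cluster of $\Lambda$ is a family $(P_i)_{i\le m}$ of finite sets $P_i\subset\Lambda_i$. Put $\Xi(\Lambda):=\bigcup_{i\le m}(\Lambda_i-\Lambda_i)$. A linear map $Q:\mathbb{R}^d\to\mathbb{R}^d$ is expansive if there are $c>1$ and a metric $e$ on $\mathbb{R}^d$, compatible with the standard topology, such that $e(Qx,Qy)\ge c\,e(x,y)$ for all $x,y$. A Delone multi-colour set $\Lambda$ is a substitution Delone multi-colour set, with expansive map $Q$ and finite sets $\mathcal{D}_{ij}\subset\mathbb{R}^d$ ($i,j\le m$), if $$\Lambda_i=\bigcup_{j=1}^m (Q\Lambda_j+\mathcal{D}_{ij}),\qquad i\le m,$$ where the unions over $j$ are disjoint; it is primitive if some power of the matrix $(\#\mathcal{D}_{ij})_{i,j\le m}$ with a positive exponent has only positive entries. For a multi-colour set $\Gamma$ put $\Phi(\Gamma)_i:=\bigcup_{j}(Q\Gamma_j+\mathcal{D}_{ij})$;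 for $x\in\Lambda_j$ let $\Phi^k(x)$ be the $k$-th iterate of $\Phi$ at the multi-colour set that consists of the single point $x$ with colour $j$. A cluster $P$ is legal if there are $k\ge 1$, $a\in\mathbb{R}^d$, $j\le m$ and $x\in\Lambda_j$ with $a+P_i\subset\Phi^k(x)_i$ for all $i\le m$. A cut and project scheme (CPS) consists of a locally compact (Hausdorff) Abelian group $H$ and a discrete subgroup $\widetilde L\subset\mathbb{R}^d\times H$ with compact quotient $(\mathbb{R}^d\times H)/\widetilde L$ such that the projection $\pi_1$ to $\mathbb{R}^d$ is injective on $\widetilde L$ and the image $\pi_2(\widetilde L)$ of the projection to $H$ is dense. For $V\subset H$ put $\Lambda(V):=\{\pi_1(x):x\in\widetilde L,\ \pi_2(x)\in V\}$. A set $\Gamma\subset\mathbb{R}^d$ is an inter model set with respect to the CPS if $s+\Lambda(W^\circ)\subset\Gamma\subset s+\Lambda(W)$ for some $s\in\mathbb{R}^d$ and some compact $W\subset H$ with $W=\overline{W^\circ}\ne\emptyset$. $\Lambda$ is an inter model multi-colour set if every $\Lambda_i$ is an inter model set with respect to the same CPS. **Theorem.** Let $\Lambda=(\Lambda_i)_{i\le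 m}$ be a primitive substitution Delone multi-colour set in $\mathbb{R}^d$ with expansive map $Q$ such that every cluster of $\Lambda$ is legal. If $\Lambda$ is an inter model multi-colour set in some CPS, then $\Lambda$ admits an algebraic coincidence: there exist $M\ge 1$, $i\le m$ and $\xi\in\Lambda_i$ such that $$\xi+Q^M\,\Xi(\Lambda)\subset\Lambda_i .$$ -/

import Mathlib

open scoped Pointwise

/-- The Euclidean space `ℝ^d`. -/
abbrev Space (d : ℕ) : Type := EuclideanSpace ℝ (Fin d)

/-- An `m`-multi-colour set `(Λ_1, …, Λ_m)` in `ℝ^d`. -/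
abbrev MultiColourSet (d m : ℕ) : Type := Fin m → Set (Space d)

namespace MultiColourSet

/-- A Delone set: uniformly discrete and relatively dense. -/
def IsDeloneSet {d : ℕ} (S : Set (Space d)) : Prop :=
  ∃ D : Delone.DeloneSet (Space d), D.carrier = S

/-- `supp Λ`, the union of all the colour classes. -/
def supp {d m : ℕ} (Λ : MultiColourSet d m) : Set (Space d) := ⋃ i, Λ i

/-- A Delone multi-colour set: every colour class and the support are Delone sets. -/
structure IsDelone {d m : ℕ} (Λ : MultiColourSet d m) : Prop where
  colour : ∀ i, IsDeloneSet (Λ i)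
  support : IsDeloneSet Λ.supp

/-- `P` is a cluster of `Λ`: each `P_i` is a finite subset of `Λ_i`. -/
def IsCluster {d m : ℕ} (Λ P : MultiColourSet d m) : Prop :=
  ∀ i, (P i).Finite ∧ P i ⊆ Λ i

/-- `Ξ(Λ)`, the union over the colours of the difference sets `Λ_i - Λ_i`. -/
def Xi {d m : ℕ} (Λ : MultiColourSet d m) : Set (Space d) := ⋃ i, (Λ i - Λ i)

/-- The multi-colour set that consists of the single point `x` with colour `j`. -/
def single {d m : ℕ} (j : Fin m) (x : Space d) : MultiColourSet d m :=
  fun i => {y | i = j ∧ y = x}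

end MultiColourSet

/-- `e` is a metric on `ℝ^d` that induces the standard topology. -/
structure IsCompatibleMetric {d : ℕ} (e : Space d → Space d → ℝ) : Prop where
  eq_zero_iff : ∀ x y, e x y = 0 ↔ x = y
  symm : ∀ x y, e x y = e y x
  triangle : ∀ x y z, e x z ≤ e x y + e y z
  isOpen_iff : ∀ s : Set (Space d), IsOpen s ↔ ∀ x ∈ s, ∃ ε > 0, ∀ y, e x y < ε → y ∈ s

/-- `Q` is expansive: it expands some compatible metric by a factor `c > 1`. -/
def IsExpansive {d : ℕ} (Q : Space d →ₗ[ℝ] Space d) : Prop :=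
  ∃ e : Space d → Space d → ℝ, IsCompatibleMetric e ∧
    ∃ c : ℝ, 1 < c ∧ ∀ x y, c * e x y ≤ e (Q x) (Q y)

/-- A family of finite sets `D_ij ⊆ ℝ^d`, `i, j ≤ m`. -/
abbrev Digits (d m : ℕ) : Type := Fin m → Fin m → Finset (Space d)

/-- The matrix function system `Φ`, as a map of multi-colour sets:
`Φ(Γ)_i = ⋃_j (Q Γ_j + D_ij)`. -/
def mfs {d m : ℕ} (Q : Space d →ₗ[ℝ] Space d) (D : Digits d m) (Γ : MultiColourSet d m) :
    MultiColourSet d m :=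
  fun i => ⋃ j, (Q '' Γ j + (D i j : Set (Space d)))

/-- The substitution matrix `S_ij = #D_ij`. -/
def substitutionMatrix {d m : ℕ} (D : Digits d m) : Matrix (Fin m) (Fin m) ℝ :=
  Matrix.of fun i j => ((D i j).card : ℝ)

namespace MultiColourSet

/-- `Λ` is a primitive substitution Delone multi-colour set with expansive map `Q` and digit
sets `D_ij`. -/
structure IsPrimitiveSubstitution {d m : ℕ} (Λ : MultiColourSet d m)
    (Q : Space d →ₗ[ℝ] Space d) (D : Digits d m) : Prop where
  delone : Λ.IsDelone
  expansive : IsExpansive Q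
  eq_mfs : ∀ i, Λ i = ⋃ j, (Q '' Λ j + (D i j : Set (Space d)))
  disjoint : ∀ i, Pairwise fun j k =>
    Disjoint (Q '' Λ j + (D i j : Set (Space d))) (Q '' Λ k + (D i k : Set (Space d)))
  primitive : (substitutionMatrix D).IsPrimitive

/-- `P` is legal: some translate of `P` is contained in the cluster `Φ^k(x)` generated from one
point `x` of `Λ`, for some `k ≥ 1`. -/
def IsLegal {d m : ℕ} (Λ : MultiColourSet d m) (Q : Space d →ₗ[ℝ] Space d) (D : Digits d m)
    (P : MultiColourSet d m) : Prop :=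
  ∃ k : ℕ, 1 ≤ k ∧ ∃ a : Space d, ∃ j : Fin m, ∃ x ∈ Λ j,
    ∀ i, a +ᵥ P i ⊆ ((mfs Q D)^[k] (single j x)) i

/-- `Λ` admits an algebraic coincidence: `ξ + Q^M Ξ(Λ) ⊆ Λ_i` for some `M ≥ 1`, some colour `i`
and some `ξ ∈ Λ_i`. -/
def AdmitsAlgebraicCoincidence {d m : ℕ} (Λ : MultiColourSet d m)
    (Q : Space d →ₗ[ℝ] Space d) : Prop :=
  ∃ M : ℕ, 1 ≤ M ∧ ∃ i : Fin m, ∃ ξ ∈ Λ i, ξ +ᵥ ((Q ^ M) '' Λ.Xi) ⊆ Λ i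

end MultiColourSet

/-- A cut and project scheme with physical space `ℝ^d` and internal space `H`: a lattice
(discrete cocompact subgroup) in `ℝ^d × H` on which the first projection is injective and whose
image under the second projection is dense in `H`. -/
structure CutProjectScheme (d : ℕ) (H : Type*) [AddCommGroup H] [TopologicalSpace H]
    [IsTopologicalAddGroup H] [LocallyCompactSpace H] [T2Space H] where
  lattice : AddSubgroup (Space d × H)
  discrete : DiscreteTopology lattice
  cocompact : CompactSpace ((Space d × H) ⧸ lattice)
  injOn_fst : Set.InjOn Prod.fst (lattice : Set (Space d × H))
  dense_snd : Dense (Prod.snd '' (lattice : Set (Space d × H)))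

namespace CutProjectScheme

/-- `Λ(V) = {π₁(x) : x ∈ L̃, π₂(x) ∈ V}`. -/
def project {d : ℕ} {H : Type*} [AddCommGroup H] [TopologicalSpace H]
    [IsTopologicalAddGroup H] [LocallyCompactSpace H] [T2Space H]
    (C : CutProjectScheme d H) (V : Set H) : Set (Space d) :=
  Prod.fst '' {x : Space d × H | x ∈ C.lattice ∧ x.2 ∈ V}

/-- `Γ` is an inter model set with respect to `C`: `s + Λ(W°) ⊆ Γ ⊆ s + Λ(W)` for some
`s ∈ ℝ^d` and some non-empty compact window `W` that is the closure of its interior. -/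
def IsInterModelSet {d : ℕ} {H : Type*} [AddCommGroup H] [TopologicalSpace H]
    [IsTopologicalAddGroup H] [LocallyCompactSpace H] [T2Space H]
    (C : CutProjectScheme d H) (Γ : Set (Space d)) : Prop :=
  ∃ (s : Space d) (W : Set H), IsCompact W ∧ W = closure (interior W) ∧ W.Nonempty ∧
    s +ᵥ C.project (interior W) ⊆ Γ ∧ Γ ⊆ s +ᵥ C.project W

/-- An inter model multi-colour set: every colour class is an inter model set with respect to
the same cut and project scheme. -/
def IsInterModelMultiColourSet {d m : ℕ} {H : Type*} [AddCommGroup H] [TopologicalSpace H]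
    [IsTopologicalAddGroup H] [LocallyCompactSpace H] [T2Space H]
    (C : CutProjectScheme d H) (Λ : MultiColourSet d m) : Prop :=
  ∀ i, C.IsInterModelSet (Λ i)

end CutProjectScheme

/-! Fix a colour `i` with window `W` and a finite cluster in `Λ i` whose internal coordinates are
`V`-dense in `W`. Legality and primitivity give one `M` such that `Q ^ M` of any `x ∈ Λ j`, shifted
by a vector depending only on `j`, carries this cluster back into `Λ i` (`exists_translate_subset`).
Such a translation lifts to a lattice vector whose internal part is a period of `W` up to `V`
(`exists_approx_period`). For `x, y ∈ Λ j` the shifts cancel, so `Q ^ M (x - y)` lifts to a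
difference of approximate periods. Exact periods of a compact set form a group and preserve its
interior; by compactness, for small `V` such differences keep a chosen interior point inside
(`exists_nhds_add_sub_mem_interior`). The point of `Λ i` over it is `ξ`. -/

open Filter Topology

/-! ### Periods and approximate periods of compact sets -/

section Group

variable {H : Type*} [AddCommGroup H] [TopologicalSpace H] [IsTopologicalAddGroup H]

/-- A translation that maps a compact set into itself has an inverse with the same property. -/
theorem IsCompact.sub_mem_of_add_mem [T2Space H] {W : Set H} (hW : IsCompact W) {b : H}
    (hb : ∀ w ∈ W, w + b ∈ W) : ∀ w ∈ W, w - b ∈ W := by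
  intro w hw
  have hn : ∀ n : ℕ, w + n • b ∈ W := by
    intro n
    induction n with
    | zero => simpa using hw
    | succ n ih =>
      have := hb _ ih
      rwa [add_assoc, ← succ_nsmul] at this
  obtain ⟨g, -, hg⟩ := hW.exists_mapClusterPt (f := (atTop : Filter ℕ))
    (u := fun n => w + n • b) (tendsto_principal.2 (Eventually.of_forall hn))
  by_contra hc
  have hnhds : Wᶜ ∈ 𝓝 (w - b) := hW.isClosed.isOpen_compl.mem_nhds hc
  have hcont : Tendsto (fun p : H × H => w - b + (p.1 - p.2)) (𝓝 g ×ˢ 𝓝 g) (𝓝 (w - b)) := by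
    have : Continuous (fun p : H × H => w - b + (p.1 - p.2)) := by fun_prop
    have := this.tendsto (g, g)
    rwa [nhds_prod_eq, sub_self, add_zero] at this
  obtain ⟨U, hU, hUW⟩ := mem_prod_self_iff.1 (hcont hnhds)
  have hfreq := mapClusterPt_iff_frequently.1 hg U hU
  obtain ⟨n, hnU⟩ := hfreq.exists
  -- A return time `k > n` makes `(k - n) • b` nearly zero, so `w - b` is close to `w + (k - n - 1)
  -- • b ∈ W`.
  obtain ⟨k, hk, hkU⟩ := (frequently_atTop.1 hfreq) (n + 1)
  obtain ⟨r, rfl⟩ := Nat.exists_eq_add_of_le hk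
  have hmem : w - b + ((w + (n + 1 + r) • b) - (w + n • b)) ∈ Wᶜ :=
    hUW (Set.mk_mem_prod hkU hnU)
  apply hmem
  have : w - b + ((w + (n + 1 + r) • b) - (w + n • b)) = w + r • b := by
    simp only [add_nsmul, one_nsmul]
    abel
  rw [this]
  exact hn r

/-- Differences of approximate periods of a compact set `W` move a given interior point of `W`
only within the interior of `W`. -/
theorem IsCompact.exists_nhds_add_sub_mem_interior [T2Space H]
    {W : Set H} (hW : IsCompact W) {w₀ : H} (hw₀ : w₀ ∈ interior W) :
    ∃ V ∈ 𝓝 (0 : H), ∀ b c : H, (∀ w ∈ W, ∃ v ∈ V, w + b - v ∈ W) →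
      (∀ w ∈ W, ∃ v ∈ V, w + c - v ∈ W) → w₀ + (c - b) ∈ interior W := by
  by_contra! hcon
  choose! b c hb hc hbc using hcon
  choose! f hfV hfW using hb
  choose! g hgV hgW using hc
  -- Counterexamples are indexed by neighbourhoods shrinking to `0`; an ultrafilter on these
  -- replaces subsequences, as `H` need not be first countable.
  have hne : ((𝓝 (0 : H)).smallSets ⊓ 𝓟 {V | V ∈ 𝓝 (0 : H)}).NeBot := by
    refine inf_principal_neBot_iff.2 fun S hS => ?_
    obtain ⟨T, hT, hTS⟩ := eventually_smallSets.1 hS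
    exact ⟨T, hTS T subset_rfl, hT⟩
  let F : Ultrafilter (Set H) := Ultrafilter.of ((𝓝 (0 : H)).smallSets ⊓ 𝓟 {V | V ∈ 𝓝 (0 : H)})
  have hF : (F : Filter (Set H)) ≤ (𝓝 (0 : H)).smallSets :=
    (Ultrafilter.of_le _).trans inf_le_left
  -- the approximate periods of ever better quality converge to a period along `F`
  have lim : ∀ (b : Set H → H) (f : Set H → H → H),
      (∀ᶠ V in F, ∀ w ∈ W, f V w ∈ V) → (∀ᶠ V in F, ∀ w ∈ W, w + b V - f V w ∈ W) →
      ∃ b', Tendsto b F (𝓝 b') ∧ ∀ w ∈ W, w + b' ∈ W := by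
    intro b f hfV hfW
    have hf0 : ∀ w ∈ W, Tendsto (fun V => f V w) F (𝓝 0) := fun w hw => tendsto_def.2 fun S hS => by
      filter_upwards [hfV, hF (eventually_smallSets_subset.2 hS)] with V h1 h2
      exact h2 (h1 w hw)
    -- One base point suffices to fix the limit of `b`, since the errors `f V w₁` tend to `0`.
    obtain ⟨w₁, hw₁⟩ : W.Nonempty := ⟨w₀, interior_subset hw₀⟩
    obtain ⟨u, hu, hlim⟩ := hW.ultrafilter_le_nhds (F.map fun V => w₁ + b V - f V w₁)
      (tendsto_principal.2 (hfW.mono fun V h => h w₁ hw₁))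
    have hb : Tendsto b F (𝓝 (u + 0 - w₁)) := by
      refine (((tendsto_id'.2 hlim).comp tendsto_map).add (hf0 w₁ hw₁)).sub_const w₁ |>.congr ?_
      intro V
      simp only [id, Function.comp]
      abel
    refine ⟨_, hb, fun w hw => ?_⟩
    have hw' := (hb.const_add w).sub (hf0 w hw)
    rw [sub_zero] at hw'
    exact hW.isClosed.mem_of_tendsto hw' (hfW.mono fun V h => h w hw)
  have hmem : ∀ᶠ V in F, V ∈ 𝓝 (0 : H) :=
    tendsto_principal.1 ((Ultrafilter.of_le _).trans inf_le_right)
  obtain ⟨b', hb', hbW⟩ := lim b f (hmem.mono hfV) (hmem.mono hfW)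
  obtain ⟨c', hc', hcW⟩ := lim c g (hmem.mono hgV) (hmem.mono hgW)
  have hnot : w₀ + (c' - b') ∉ interior W :=
    (isOpen_interior.isClosed_compl).mem_of_tendsto ((hc'.sub hb').const_add w₀)
      (hmem.mono hbc)
  apply hnot
  -- Translation by `c' - b'` maps `W` into itself, so the translate of `interior W` is an open
  -- subset of `W`.
  have hsub := hW.sub_mem_of_add_mem hbW
  refine mem_interior.2 ⟨(fun x => x - (c' - b')) ⁻¹' interior W, fun x hx => ?_,
    isOpen_interior.preimage (by fun_prop), by simpa using hw₀⟩
  have hxW : x - (c' - b') ∈ W := interior_subset hx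
  have := hcW _ (hsub _ hxW)
  rwa [show x - (c' - b') - b' + c' = x by abel] at this

end Group

/-! ### Iterated substitution and recurrence of clusters -/

theorem mfs_mono {d m : ℕ} (Q : Space d →ₗ[ℝ] Space d) (D : Digits d m) :
    Monotone (mfs Q D) := by
  intro Γ Γ' h i
  exact Set.iUnion_mono fun j => Set.add_subset_add_right (Set.image_mono (h j))

theorem mfs_vadd {d m : ℕ} (Q : Space d →ₗ[ℝ] Space d) (D : Digits d m)
    (x : Space d) (Γ : MultiColourSet d m) : mfs Q D (x +ᵥ Γ) = Q x +ᵥ mfs Q D Γ := by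
  funext i
  ext y
  simp only [mfs, Pi.vadd_apply, Set.mem_iUnion, Set.mem_add, Set.mem_image, Set.mem_vadd_set,
    vadd_eq_add, exists_exists_and_eq_and, map_add]
  constructor
  · rintro ⟨j, u, hu, e, he, rfl⟩
    exact ⟨Q u + e, ⟨j, u, hu, e, he, rfl⟩, by abel⟩
  · rintro ⟨_, ⟨j, u, hu, e, he, rfl⟩, rfl⟩
    exact ⟨j, u, hu, e, he, by abel⟩

theorem mfs_iterate_vadd {d m : ℕ} (Q : Space d →ₗ[ℝ] Space d) (D : Digits d m) (n : ℕ)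
    (x : Space d) (Γ : MultiColourSet d m) :
    (mfs Q D)^[n] (x +ᵥ Γ) = (Q ^ n) x +ᵥ (mfs Q D)^[n] Γ := by
  induction n generalizing x Γ with
  | zero => simp
  | succ n ih =>
    rw [Function.iterate_succ_apply, mfs_vadd, ih, Function.iterate_succ_apply, pow_succ]
    rfl

/-- A nonzero entry of the power yields a path from `j` to `i` through nonempty digit sets. -/
theorem mfs_iterate_single_nonempty {d m : ℕ} (Q : Space d →ₗ[ℝ] Space d) (D : Digits d m)
    (n : ℕ) (i j : Fin m) (x : Space d) (h : (substitutionMatrix D ^ n) i j ≠ 0) :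
    ((mfs Q D)^[n] (MultiColourSet.single j x) i).Nonempty := by
  induction n generalizing i with
  | zero =>
    have hij : i = j := by
      by_contra hij
      exact h (by simp [Matrix.one_apply_ne hij])
    exact ⟨x, hij, rfl⟩
  | succ n ih =>
    rw [pow_succ', Matrix.mul_apply] at h
    obtain ⟨l, -, hl⟩ := Finset.exists_ne_zero_of_sum_ne_zero h
    obtain ⟨y, hy⟩ := ih l (right_ne_zero_of_mul hl)
    have hD : (D i l).Nonempty := by
      rw [← Finset.card_ne_zero]
      intro h0
      exact left_ne_zero_of_mul hl (by simp [substitutionMatrix, h0])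
    obtain ⟨e, he⟩ := hD
    rw [Function.iterate_succ_apply']
    exact ⟨Q y + e, Set.mem_iUnion.2 ⟨l, Set.add_mem_add ⟨y, hy, rfl⟩ he⟩⟩

namespace MultiColourSet

theorem single_le {d m : ℕ} {Γ : MultiColourSet d m} {j : Fin m} {x : Space d}
    (hx : x ∈ Γ j) : single j x ≤ Γ := by
  rintro i y ⟨rfl, rfl⟩
  exact hx

theorem single_eq_vadd {d m : ℕ} (j : Fin m) (x y : Space d) :
    single j (x + y) = x +ᵥ single j y := by
  funext i
  ext z
  simp only [single, Pi.vadd_apply, Set.mem_vadd_set, Set.mem_ofPred_eq, vadd_eq_add]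
  constructor
  · rintro ⟨rfl, rfl⟩
    exact ⟨y, ⟨rfl, rfl⟩, rfl⟩
  · rintro ⟨_, ⟨rfl, rfl⟩, rfl⟩
    exact ⟨rfl, rfl⟩

variable {d m : ℕ} {Λ : MultiColourSet d m} {Q : Space d →ₗ[ℝ] Space d} {D : Digits d m}

theorem IsPrimitiveSubstitution.iterate_eq (hΛ : Λ.IsPrimitiveSubstitution Q D) (n : ℕ) :
    (mfs Q D)^[n] Λ = Λ :=
  Function.iterate_fixed (funext fun i => (hΛ.eq_mfs i).symm) n

/-- A finite subset of one colour class recurs in every inflated point of a suitable order. -/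
theorem IsPrimitiveSubstitution.exists_translate_subset (hΛ : Λ.IsPrimitiveSubstitution Q D)
    (hlegal : ∀ P : MultiColourSet d m, Λ.IsCluster P → Λ.IsLegal Q D P) {i : Fin m}
    {P : Set (Space d)} (hP : P.Finite) (hPΛ : P ⊆ Λ i) :
    ∃ M : ℕ, 1 ≤ M ∧ ∀ j, ∃ a : Space d, ∀ x ∈ Λ j, ∀ p ∈ P, (Q ^ M) x + a + p ∈ Λ i := by
  have hclus : Λ.IsCluster (fun l => {p | l = i ∧ p ∈ P}) := by
    intro l
    refine ⟨hP.subset fun p hp => hp.2, ?_⟩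
    rintro p ⟨rfl, hp⟩
    exact hPΛ hp
  obtain ⟨k, hk, a, j₀, x₀, -, h⟩ := hlegal _ hclus
  obtain ⟨-, r, -, hr⟩ := hΛ.primitive
  refine ⟨k + r, by omega, fun j => ?_⟩
  -- Inflating the origin rather than `x` keeps the shift independent of `x`; its term `(Q ^ k) (y -
  -- x₀)` moves the `k`-th iterate at `x₀` to the one at `y`.
  obtain ⟨y, hy⟩ := mfs_iterate_single_nonempty Q D r j₀ j 0 (hr j₀ j).ne'
  refine ⟨(Q ^ k) (y - x₀) + a, fun x hx p hp => ?_⟩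
  have h1 : a + p ∈ (mfs Q D)^[k] (single j₀ x₀) i :=
    h i (Set.vadd_mem_vadd_set ⟨rfl, hp⟩)
  have h2 : (Q ^ k) (y - x₀) + (a + p) ∈ (mfs Q D)^[k] (single j₀ y) i := by
    rw [← sub_add_cancel y x₀, single_eq_vadd, mfs_iterate_vadd, sub_add_cancel]
    exact Set.vadd_mem_vadd_set h1
  have h3 := (mfs_mono Q D).iterate k (single_le hy) i h2
  rw [← Function.iterate_add_apply] at h3
  have h4 : (Q ^ (k + r)) x + ((Q ^ k) (y - x₀) + (a + p)) ∈
      (mfs Q D)^[k + r] (single j x) i := by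
    rw [← add_zero x, single_eq_vadd, mfs_iterate_vadd, add_zero]
    exact Set.vadd_mem_vadd_set h3
  have h5 := (mfs_mono Q D).iterate (k + r) (single_le hx) i h4
  rw [hΛ.iterate_eq] at h5
  simpa only [add_assoc] using h5

theorem IsDelone.nonempty_colours (h : Λ.IsDelone) : Nonempty (Fin m) := by
  obtain ⟨S, hS⟩ := h.support
  obtain ⟨x, hx⟩ : S.carrier.Nonempty := S.nonempty
  rw [hS] at hx
  exact ⟨(Set.mem_iUnion.1 hx).choose⟩

end MultiColourSet

/-! ### Lattice points and windows -/

namespace CutProjectScheme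

variable {d : ℕ} {H : Type*} [AddCommGroup H] [TopologicalSpace H] [IsTopologicalAddGroup H]
  [LocallyCompactSpace H] [T2Space H] (C : CutProjectScheme d H)

theorem mem_vadd_project {s x : Space d} {V : Set H} :
    x ∈ s +ᵥ C.project V ↔ ∃ l ∈ C.lattice, l.2 ∈ V ∧ x = s + l.1 := by
  simp only [project, Set.mem_vadd_set, Set.mem_image, Set.mem_ofPred_eq, vadd_eq_add]
  constructor
  · rintro ⟨_, ⟨l, ⟨h1, h2⟩, rfl⟩, rfl⟩
    exact ⟨l, h1, h2, rfl⟩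
  · rintro ⟨l, h1, h2, rfl⟩
    exact ⟨_, ⟨l, ⟨h1, h2⟩, rfl⟩, rfl⟩

/-- Lattice points over the interior of a window are, up to `V`, dense in the window: finitely
many of them suffice. -/
theorem exists_finite_approx {W : Set H} (hW : IsCompact W) (hWi : W = closure (interior W))
    {V : Set H} (hV : V ∈ 𝓝 (0 : H)) :
    ∃ F : Set (Space d × H), F.Finite ∧ (∀ l ∈ F, l ∈ C.lattice ∧ l.2 ∈ interior W) ∧
      ∀ w ∈ W, ∃ l ∈ F, w - l.2 ∈ V := by
  have hopen : ∀ w ∈ W, ∃ l ∈ C.lattice, l.2 ∈ interior W ∧ {x | x - l.2 ∈ V} ∈ 𝓝 w := by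
    intro w hw
    obtain ⟨U, hUV, hU, h0⟩ := mem_nhds_iff.1 hV
    have hO : IsOpen {z : H | w - z ∈ U} := hU.preimage (by fun_prop)
    rw [hWi] at hw
    obtain ⟨z, hz, hzW⟩ := mem_closure_iff.1 hw _ hO (by simpa using h0)
    obtain ⟨_, ⟨hz1, hz2⟩, l, hl, rfl⟩ :=
      C.dense_snd.inter_open_nonempty _ (hO.inter isOpen_interior) ⟨z, hz, hzW⟩
    refine ⟨l, hl, hz2, mem_of_superset ((hU.preimage
      (continuous_id.sub continuous_const)).mem_nhds hz1) fun x hx => hUV hx⟩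
  choose! f hf using hopen
  obtain ⟨t, ht, hcov⟩ := hW.elim_nhds_subcover (fun w => {x | x - (f w).2 ∈ V})
    fun w hw => (hf w hw).2.2
  refine ⟨f '' t, t.finite_toSet.image f, ?_, fun w hw => ?_⟩
  · rintro _ ⟨w, hw, rfl⟩
    exact ⟨(hf w (ht w hw)).1, (hf w (ht w hw)).2.1⟩
  · obtain ⟨x, hx, hwx⟩ := Set.mem_iUnion₂.1 (hcov hw)
    exact ⟨f x, ⟨x, hx, rfl⟩, hwx⟩

/-- A translation that carries a nonempty finite approximation of the window into the model set
comes from a lattice vector whose internal part is an approximate period of the window. -/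
theorem exists_approx_period {W V : Set H} {s b : Space d} {F : Set (Space d × H)}
    (hne : F.Nonempty) (hF : ∀ l ∈ F, l ∈ C.lattice) (hFW : ∀ w ∈ W, ∃ l ∈ F, w - l.2 ∈ V)
    (hb : ∀ l ∈ F, b + (s + l.1) ∈ s +ᵥ C.project W) :
    ∃ q ∈ C.lattice, q.1 = b ∧ ∀ w ∈ W, ∃ v ∈ V, w + q.2 - v ∈ W := by
  have key : ∀ l ∈ F, ∃ q ∈ C.lattice, q.1 = b ∧ l.2 + q.2 ∈ W := by
    intro l hl
    obtain ⟨l', hl', hW', h⟩ := C.mem_vadd_project.1 (hb l hl)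
    refine ⟨l' - l, C.lattice.sub_mem hl' (hF l hl), ?_, by simpa using hW'⟩
    rw [Prod.fst_sub, sub_eq_iff_eq_add]
    apply add_left_cancel (a := s)
    rw [← h]
    abel
  obtain ⟨l₀, hl₀⟩ := hne
  obtain ⟨q, hq, hqb, -⟩ := key l₀ hl₀
  refine ⟨q, hq, hqb, fun w hw => ?_⟩
  obtain ⟨l, hl, hlV⟩ := hFW w hw
  obtain ⟨q', hq', hqb', hW'⟩ := key l hl
  -- Injectivity of the first projection gives the same lattice vector for every `l`, hence one
  -- approximate period for all of `W`.
  have : q' = q := C.injOn_fst hq' hq (hqb'.trans hqb.symm)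
  subst this
  exact ⟨w - l.2, hlV, by convert hW' using 1; abel⟩

end CutProjectScheme

theorem mainTheorem4 {d m : ℕ} (Λ : MultiColourSet d m)
    (Q : Space d →ₗ[ℝ] Space d) (D : Digits d m)
    (hΛ : Λ.IsPrimitiveSubstitution Q D)
    (hlegal : ∀ P : MultiColourSet d m, Λ.IsCluster P → Λ.IsLegal Q D P)
    {H : Type*} [AddCommGroup H] [TopologicalSpace H] [IsTopologicalAddGroup H]
    [LocallyCompactSpace H] [T2Space H] (C : CutProjectScheme d H)
    (hC : C.IsInterModelMultiColourSet Λ) :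
    Λ.AdmitsAlgebraicCoincidence Q := by
  obtain ⟨i⟩ := hΛ.delone.nonempty_colours
  obtain ⟨s, W, hW, hWi, hWne, hlow, hup⟩ := hC i
  have hint : (interior W).Nonempty := by
    rw [hWi] at hWne
    exact closure_nonempty_iff.1 hWne
  obtain ⟨_, hl₀W, l₀, hl₀, rfl⟩ := C.dense_snd.inter_open_nonempty _ isOpen_interior hint
  obtain ⟨V, hV, hVW⟩ := hW.exists_nhds_add_sub_mem_interior hl₀W
  obtain ⟨F, hFfin, hF, hFW⟩ := C.exists_finite_approx hW hWi hV
  have hFne : F.Nonempty := by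
    obtain ⟨w, hw⟩ := hWne
    obtain ⟨l, hl, -⟩ := hFW w hw
    exact ⟨l, hl⟩
  have hFΛ : (fun l : Space d × H => s + l.1) '' F ⊆ Λ i := by
    rintro _ ⟨l, hl, rfl⟩
    exact hlow (C.mem_vadd_project.2 ⟨l, (hF l hl).1, (hF l hl).2, rfl⟩)
  obtain ⟨M, hM, hrec⟩ := hΛ.exists_translate_subset hlegal (hFfin.image _) hFΛ
  refine ⟨M, hM, i, s + l₀.1, hlow (C.mem_vadd_project.2 ⟨l₀, hl₀, hl₀W, rfl⟩), ?_⟩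
  rintro _ ⟨_, ⟨α, hα, rfl⟩, rfl⟩
  obtain ⟨j, x, hx, y, hy, rfl⟩ := Set.mem_iUnion.1 hα
  obtain ⟨a, ha⟩ := hrec j
  -- The same `a` serves `x` and `y`, so it drops out of `q.1 - r.1`.
  have hper : ∀ z ∈ Λ j, ∃ q ∈ C.lattice, q.1 = (Q ^ M) z + a ∧
      ∀ w ∈ W, ∃ v ∈ V, w + q.2 - v ∈ W := fun z hz =>
    C.exists_approx_period hFne (fun l hl => (hF l hl).1) hFW
      fun l hl => hup (ha z hz _ ⟨l, hl, rfl⟩)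
  obtain ⟨q, hq, hqx, hqW⟩ := hper x hx
  obtain ⟨r, hr, hry, hrW⟩ := hper y hy
  refine hlow (C.mem_vadd_project.2 ⟨l₀ + (q - r), C.lattice.add_mem hl₀ (C.lattice.sub_mem hq hr),
    hVW _ _ hrW hqW, ?_⟩)
  simp only [vadd_eq_add, Prod.fst_add, Prod.fst_sub, hqx, hry, map_sub]
  abel
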